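/- Let $M$ be any model of ZF (the axiom of choice is not assumed); equivalently, the following is a theorem of ZF. In $M$, let $\mathbb P=(\mathbb P,\unlhd)$ be a partial order (only reflexivity and transitivity are used) with a greatest element $\mathbf 1$. A $\mathbb P$-name is, recursively, a set of pairs $(s,\pi)$ with $s\in\mathbb P$ and $\pi$ a $\mathbb P$-name; $\check x=\{(\mathbf 1,\check y): y\in x\}$ is the standard name of $x$; and $\Vdash$ is the usual forcing relation, defined in $M$ by recursion, so that in particular $p\Vdash\exists x\,\varphi(x)$ iff for every $q\unlhd p$ there are $r\unlhd q$ and a name $\tau$ with $r\Vdash\varphi(\tau)$. Let $\kappa$ be an ordinal of $M$, let $p\in\mathbb P$, and let $\theta(x)$ be a first-order formula of the language $\{\in\}$, with $\mathbb P$-names as parameters, such that $$p\Vdash\exists\alpha<\check\kappa\;\;\theta(\alpha).$$ Then there is a $\mathbb P$-name $\tau$ such that $p\Vdash\theta(\tau)$. Moreover $\tau$ can be taken to be a name for the least ordinal satisfying $\theta$: $p$ also forces that $\tau$ is an ordinal and that no $\gamma\in\tau$ satisfies $\theta$. -/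

import Mathlib

open scoped FirstOrder

universe u

namespace ZFForcing

/-! ### The language of set theory and models of ZF -/

/-- The only non-logical symbol of the language of set theory: binary membership. -/
inductive MemSymb : ℕ → Type
  | mem : MemSymb 2

/-- The first-order language `{∈}` of set theory (with equality). -/
def setLang : FirstOrder.Language.{0, 0} := ⟨fun _ => Empty, MemSymb⟩

/-- The membership symbol. -/
abbrev memSym : setLang.Relations 2 := MemSymb.mem

/-- The atomic formula `s ∈ t`. -/
def memF {α : Type u} {n : ℕ} (s t : setLang.Term (α ⊕ Fin n)) : setLang.BoundedFormula α n :=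
  memSym.boundedFormula₂ s t

/-- A free variable, used as a constant symbol. -/
def cst {α : Type u} {n : ℕ} (a : α) : setLang.Term (α ⊕ Fin n) := FirstOrder.Language.Term.var (Sum.inl a)

section Internal

variable {M : Type u} [setLang.Structure M]

/-- The membership relation of the structure `M`. -/
def EMem (x y : M) : Prop := FirstOrder.Language.Structure.RelMap memSym ![x, y]

infix:50 " ∈ₘ " => EMem

/-- `w = {x, y}` in `M`. -/
def IsUPair (w x y : M) : Prop := ∀ t, t ∈ₘ w ↔ t = x ∨ t = y

/-- `z = (x, y)` (Kuratowski pair) in `M`. -/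
def IsPair (z x y : M) : Prop := ∃ a b, IsUPair a x x ∧ IsUPair b x y ∧ IsUPair z a b

/-- `(x, y) ∈ r` in `M`. -/
def PairMem (x y r : M) : Prop := ∃ z, IsPair z x y ∧ z ∈ₘ r

/-- `(x, (y, z)) ∈ r` in `M`. -/
def TripleMem (x y z r : M) : Prop := ∃ w, IsPair w y z ∧ PairMem x w r

/-- `x` is a transitive set of `M`. -/
def IsTrSet (x : M) : Prop := ∀ y, y ∈ₘ x → ∀ z, z ∈ₘ y → z ∈ₘ x

/-- `x` is a von Neumann ordinal of `M`: a transitive set of transitive sets. -/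
def IsOrd (x : M) : Prop := IsTrSet x ∧ ∀ y, y ∈ₘ x → IsTrSet y

end Internal

/-- `M` is a model of Zermelo-Fraenkel set theory (without choice). In the two schemata `φ` ranges
over all first-order formulas of the language `{∈}` with parameters from `M`: the free variables of
`φ` are elements of `M`, each interpreted by itself, besides the displayed variables. -/
structure ModelsZF (M : Type u) [setLang.Structure M] : Prop where
  extensionality : ∀ x y : M, (∀ z, z ∈ₘ x ↔ z ∈ₘ y) → x = y
  foundation : ∀ x : M, (∃ y, y ∈ₘ x) → ∃ y, y ∈ₘ x ∧ ∀ z, z ∈ₘ y → ¬ z ∈ₘ x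
  pairing : ∀ x y : M, ∃ w, IsUPair w x y
  union : ∀ x : M, ∃ u, ∀ z, z ∈ₘ u ↔ ∃ y, y ∈ₘ x ∧ z ∈ₘ y
  powerset : ∀ x : M, ∃ w, ∀ y, y ∈ₘ w ↔ ∀ z, z ∈ₘ y → z ∈ₘ x
  infinity : ∃ w : M, (∃ e, e ∈ₘ w ∧ ∀ z, ¬ z ∈ₘ e) ∧
    ∀ x, x ∈ₘ w → ∃ y, y ∈ₘ w ∧ ∀ z, z ∈ₘ y ↔ z ∈ₘ x ∨ z = x
  separation : ∀ (φ : setLang.BoundedFormula M 1) (a : M),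
    ∃ b, ∀ x, x ∈ₘ b ↔ x ∈ₘ a ∧ φ.Realize id ![x]
  replacement : ∀ (φ : setLang.BoundedFormula M 2) (a : M),
    (∀ x, x ∈ₘ a → ∀ y y', φ.Realize id ![x, y] → φ.Realize id ![x, y'] → y = y') →
      ∃ b, ∀ y, y ∈ₘ b ↔ ∃ x, x ∈ₘ a ∧ φ.Realize id ![x, y]

/-! ### Forcing inside a model -/

/-- A notion of forcing in `M`: sets `carrier`, `order`, `one` of `M` such that `order`, read as the
set of pairs `(q, p)` with `q ⊴ p`, is reflexive and transitive on `carrier`, with greatest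
element `one`. -/
structure ForcingPoset (M : Type u) [setLang.Structure M] where
  carrier : M
  order : M
  one : M
  refl : ∀ p, p ∈ₘ carrier → PairMem p p order
  trans : ∀ p q r, p ∈ₘ carrier → q ∈ₘ carrier → r ∈ₘ carrier →
    PairMem p q order → PairMem q r order → PairMem p r order
  one_mem : one ∈ₘ carrier
  le_one : ∀ p, p ∈ₘ carrier → PairMem p one order

namespace ForcingPoset

variable {M : Type u} [setLang.Structure M] (P : ForcingPoset M)

/-- `q ⊴ p`, for conditions `q` and `p`. -/
def Le (q p : M) : Prop := q ∈ₘ P.carrier ∧ p ∈ₘ P.carrier ∧ PairMem q p P.order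

/-- The class `D` of conditions is dense below `p`. -/
def DenseBelow (D : M → Prop) (p : M) : Prop := ∀ r, P.Le r p → ∃ q, P.Le q r ∧ D q

/-- Every element of a member of `T` is a pair `(s, π)` with `s` a condition and `π ∈ T`. -/
def NameClosed (T : M) : Prop :=
  ∀ y, y ∈ₘ T → ∀ z, z ∈ₘ y → ∃ s π, s ∈ₘ P.carrier ∧ π ∈ₘ T ∧ IsPair z s π

/-- `x` is a name: hereditarily, a set of pairs `(s, π)` with `s` a condition and `π` a name. -/
def IsName (x : M) : Prop := ∃ T, x ∈ₘ T ∧ P.NameClosed T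

/-- The class of names of `M`. -/
def Name : Type u := {x : M // P.IsName x}

/-- `c` is the standard name of `x`, i.e. `c = F x` for a function `F` of `M` on a transitive
set `T` containing `x`, with `F y = {(one, F w) : w ∈ y}` for all `y ∈ T`. -/
def IsCheck (x c : M) : Prop :=
  ∃ T F, x ∈ₘ T ∧ IsTrSet T ∧
    (∀ y, y ∈ₘ T → ∃! d, PairMem y d F) ∧
    (∀ y d, y ∈ₘ T → PairMem y d F →
      ∀ z, z ∈ₘ d ↔ ∃ w e, w ∈ₘ y ∧ PairMem w e F ∧ IsPair z P.one e) ∧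
    PairMem x c F

/-- The recursion clause for forcing an equality of names, where `S q π π'` stands for
`q ⊩ π = π'`, for `π` in the domain of `σ` and `π'` in the domain of `τ`. -/
def EqClause (S : M → M → M → Prop) (p σ τ : M) : Prop :=
  (∀ s π, PairMem s π σ → P.DenseBelow
    (fun q => P.Le q s → ∃ s' π', PairMem s' π' τ ∧ P.Le q s' ∧ S q π π') p) ∧
  (∀ s' π', PairMem s' π' τ → P.DenseBelow
    (fun q => P.Le q s' → ∃ s π, PairMem s π σ ∧ P.Le q s ∧ S q π π') p)

/-- `p ⊩ σ = τ`, defined by recursion on names inside `M`: the triple `(p, (σ, τ))` belongs to a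
set `A` of `M` that satisfies the recursion clause on a set `T` of names which contains `σ` and `τ`
and, together with a name, all names in its domain. -/
def ForcesEq (p σ τ : M) : Prop :=
  ∃ T A, σ ∈ₘ T ∧ τ ∈ₘ T ∧ P.NameClosed T ∧
    (∀ q a b, q ∈ₘ P.carrier → a ∈ₘ T → b ∈ₘ T →
      (TripleMem q a b A ↔ P.EqClause (fun r π π' => TripleMem r π π' A) q a b)) ∧
    TripleMem p σ τ A

/-- `p ⊩ σ ∈ τ`. -/
def ForcesMem (p σ τ : M) : Prop :=
  P.DenseBelow (fun q => ∃ s π, PairMem s π τ ∧ P.Le q s ∧ P.ForcesEq q σ π) p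

/-- The value of a term; every term of the language `{∈}` is a variable. -/
def termVal {γ N : Type u} (v : γ → N) : setLang.Term γ → N
  | .var x => v x
  | .func f _ => Empty.elim f

/-- Forcing for the relation symbols of the language. -/
def ForcesRel (p : M) : {l : ℕ} → setLang.Relations l → (Fin l → P.Name) → Prop
  | _, MemSymb.mem, ts => P.ForcesMem p (ts 0).1 (ts 1).1

/-- The forcing relation `p ⊩ φ(xs)`, by recursion on the formula `φ` of the forcing language. The
free variables of `φ` are names, used as constants; `xs` assigns names to the other variables. -/
def Forces : {n : ℕ} → M → setLang.BoundedFormula P.Name n → (Fin n → P.Name) → Prop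
  | _, _, .falsum, _ => False
  | _, p, .equal t₁ t₂, xs =>
      P.ForcesEq p (termVal (Sum.elim id (fun i => xs i)) t₁ : P.Name).1
        (termVal (Sum.elim id (fun i => xs i)) t₂ : P.Name).1
  | _, p, .rel R ts, xs => P.ForcesRel p R (fun i => termVal (Sum.elim id (fun j => xs j)) (ts i))
  | _, p, .imp φ ψ, xs => ∀ q, P.Le q p → Forces q φ xs → ∃ r, P.Le r q ∧ Forces r ψ xs
  | _, p, .all φ, xs => ∀ x : P.Name, Forces p φ (Fin.snoc xs x)

end ForcingPoset

/-- The formula expressing that the constant `a` is an ordinal (a transitive set of transitive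
sets). -/
def ordF {α : Type u} (a : α) : setLang.BoundedFormula α 0 :=
  (∀' (memF (&0) (cst a) ⟹ ∀' (memF (&1) (&0) ⟹ memF (&1) (cst a)))) ⊓
  (∀' (memF (&0) (cst a) ⟹ ∀' (memF (&1) (&0) ⟹ ∀' (memF (&2) (&1) ⟹ memF (&2) (&0)))))

/-- The formula `∃ x (x ∈ k ∧ θ(x))`. -/
def exMemF {α : Type u} (k : α) (θ : setLang.BoundedFormula α 1) : setLang.BoundedFormula α 0 :=
  ∃' (memF (&0) (cst k) ⊓ θ)

/-- The formula `∀ x (x ∈ t → ¬ θ(x))`. -/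
def noMemF {α : Type u} (t : α) (θ : setLang.BoundedFormula α 1) : setLang.BoundedFormula α 0 :=
  ∀' (memF (&0) (cst t) ⟹ ∼θ)

end ZFForcing

open ZFForcing

/-! The usual way to find a single witness, choosing names along a maximal antichain and mixing
them, needs choice. Here the candidates are the standard names γ̌ with γ ∈ κ, and the least one can
be named outright: `IsLeastName` takes for τ all pairs (s, γ̌) such that no condition below s forces
θ(δ̌) for any δ ≤ γ. Separation yields τ because forcing a fixed formula is definable
(`Dfn.forcesEl`).

Below any r ⊴ p, let γ be least such that some q ⊴ r forces θ(γ̌). No condition below q forces θ(δ̌)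
with δ ∈ γ, so q forces τ = γ̌ (`IsLeastName.forcesEq`) and hence θ(τ). Such q are dense below p, so
p forces θ(τ). A member of τ is, densely, some γ̌ for which θ is refuted up to and including γ; this
gives both minimality and ordinalhood.

Since M is an arbitrary structure, the basic theory of forcing is built inside it: induction on
names holds for definable properties only, and forced equality is obtained as a fixed point that is
a set of M (`exists_isEqRel`), shown unique, and then handled through its recursion clause
(`forcesEq_iff`). -/

namespace ZFForcing

/-! ### Definability with parameters, up to forcing of atomic formulas. -/

section Definability

open FirstOrder Language

variable {M : Type u} {m n : ℕ}

/-- Functions of tuples that are coordinates or constants. -/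
def Tm (f : (Fin n → M) → M) : Prop := (∃ i, ∀ v, f v = v i) ∨ ∃ c, ∀ v, f v = c

/-- Maps of tuples that select coordinates. -/
def Pj (g : (Fin m → M) → Fin n → M) : Prop := ∃ s : Fin n → Fin m, ∀ v i, g v i = v (s i)

theorem Pj.id : Pj (fun v : Fin n → M => v) := ⟨fun i => i, fun _ _ => rfl⟩

theorem Pj.init {g : (Fin m → M) → Fin (n + 1) → M} (h : Pj g) : Pj (fun v => Fin.init (g v)) := by
  obtain ⟨s, hs⟩ := h
  exact ⟨fun i => s i.castSucc, fun v i => hs v _⟩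

theorem Tm.const (c : M) : Tm (fun _ : Fin n → M => c) := Or.inr ⟨c, fun _ => rfl⟩

theorem Tm.coord {g : (Fin m → M) → Fin n → M} (h : Pj g) (i : Fin n) : Tm (fun v => g v i) := by
  obtain ⟨s, hs⟩ := h
  exact Or.inl ⟨s i, fun v => hs v i⟩

theorem Tm.comp {f : (Fin n → M) → M} {g : (Fin m → M) → Fin n → M} (hf : Tm f) (hg : Pj g) :
    Tm (fun v => f (g v)) := by
  obtain ⟨s, hs⟩ := hg
  rcases hf with ⟨i, hi⟩ | ⟨c, hc⟩
  · exact Or.inl ⟨s i, fun v => (hi _).trans (hs v i)⟩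
  · exact Or.inr ⟨c, fun v => hc _⟩

variable [setLang.Structure M]

/-- Predicates on tuples that are defined by a formula with parameters. -/
def Dfn (R : (Fin n → M) → Prop) : Prop :=
  ∃ φ : setLang.BoundedFormula M n, ∀ v, φ.Realize id v ↔ R v

theorem Tm.exists_term {f : (Fin n → M) → M} (hf : Tm f) :
    ∃ t : setLang.Term (M ⊕ Fin n), ∀ v, t.realize (Sum.elim _root_.id v) = f v := by
  rcases hf with ⟨i, hi⟩ | ⟨c, hc⟩
  · exact ⟨.var (Sum.inr i), fun v => by simp [hi]⟩
  · exact ⟨.var (Sum.inl c), fun v => by simp [hc]⟩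

theorem Dfn.mem {f g : (Fin n → M) → M} (hf : Tm f) (hg : Tm g) : Dfn (fun v => f v ∈ₘ g v) := by
  obtain ⟨s, hs⟩ := hf.exists_term
  obtain ⟨t, ht⟩ := hg.exists_term
  exact ⟨memF s t, fun v => by rw [memF, BoundedFormula.realize_rel₂, hs, ht]; rfl⟩

theorem Dfn.eq {f g : (Fin n → M) → M} (hf : Tm f) (hg : Tm g) : Dfn (fun v => f v = g v) := by
  obtain ⟨s, hs⟩ := hf.exists_term
  obtain ⟨t, ht⟩ := hg.exists_term
  exact ⟨s.bdEqual t, fun v => by rw [BoundedFormula.realize_bdEqual, hs, ht]⟩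

theorem Dfn.false : Dfn (fun _ : Fin n → M => False) := ⟨⊥, fun _ => Iff.rfl⟩

variable {R S : (Fin n → M) → Prop}

theorem Dfn.imp (hR : Dfn R) (hS : Dfn S) : Dfn (fun v => R v → S v) := by
  obtain ⟨φ, hφ⟩ := hR
  obtain ⟨ψ, hψ⟩ := hS
  exact ⟨φ.imp ψ, fun v => by rw [BoundedFormula.realize_imp, hφ, hψ]⟩

theorem Dfn.not (hR : Dfn R) : Dfn (fun v => ¬ R v) := hR.imp Dfn.false

theorem Dfn.of_iff (hR : Dfn R) (h : ∀ v, R v ↔ S v) : Dfn S := by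
  obtain ⟨φ, hφ⟩ := hR
  exact ⟨φ, fun v => (hφ v).trans (h v)⟩

theorem Dfn.and (hR : Dfn R) (hS : Dfn S) : Dfn (fun v => R v ∧ S v) :=
  (hR.imp hS.not).not.of_iff fun v => by tauto

theorem Dfn.or (hR : Dfn R) (hS : Dfn S) : Dfn (fun v => R v ∨ S v) :=
  (hR.not.imp hS).of_iff fun v => by tauto

theorem Dfn.iff (hR : Dfn R) (hS : Dfn S) : Dfn (fun v => R v ↔ S v) :=
  ((hR.imp hS).and (hS.imp hR)).of_iff fun v => by tauto

/-- The bound variable becomes the last coordinate and `Fin.init` recovers the outer tuple. Nested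
quantifiers thus produce iterated `Fin.init`, which is what `Pj` keeps track of. -/
theorem Dfn.all {Q : (Fin n → M) → M → Prop}
    (h : Dfn (fun v : Fin (n + 1) → M => Q (Fin.init v) (v (Fin.last n)))) :
    Dfn (fun v => ∀ x, Q v x) := by
  obtain ⟨φ, hφ⟩ := h
  exact ⟨φ.all, fun v => by simp [hφ]⟩

theorem Dfn.ex {Q : (Fin n → M) → M → Prop}
    (h : Dfn (fun v : Fin (n + 1) → M => Q (Fin.init v) (v (Fin.last n)))) :
    Dfn (fun v => ∃ x, Q v x) :=
  (Dfn.all (Q := fun v x => ¬ Q v x) h.not).not.of_iff fun v => by simp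

section Predicates

variable {f g h k : (Fin n → M) → M}

theorem Dfn.isUPair (hf : Tm f) (hg : Tm g) (hh : Tm h) :
    Dfn (fun v => IsUPair (f v) (g v) (h v)) := by
  unfold IsUPair
  -- The search follows the syntax of the unfolded predicate. Reducible transparency stops a lemma
  -- from matching by unfolding definitions, and `Tm.comp` is accepted only when its outer function
  -- is a hypothesis.
  repeat' with_reducible first
    | exact Pj.id | apply Pj.init | assumption | exact Tm.const _
    | (refine Tm.comp ?_ ?_ <;> [assumption; skip]) | apply Tm.coord
    | apply Dfn.mem | apply Dfn.eq | apply Dfn.not | apply Dfn.and | apply Dfn.or | apply Dfn.iff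
    | apply Dfn.ex | apply Dfn.imp | apply Dfn.all

theorem Dfn.isPair (hf : Tm f) (hg : Tm g) (hh : Tm h) :
    Dfn (fun v => IsPair (f v) (g v) (h v)) := by
  unfold IsPair
  repeat' with_reducible first
    | exact Pj.id | apply Pj.init | assumption | exact Tm.const _
    | (refine Tm.comp ?_ ?_ <;> [assumption; skip]) | apply Tm.coord
    | apply Dfn.isUPair
    | apply Dfn.mem | apply Dfn.eq | apply Dfn.not | apply Dfn.and | apply Dfn.or | apply Dfn.iff
    | apply Dfn.ex

theorem Dfn.pairMem (hf : Tm f) (hg : Tm g) (hh : Tm h) :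
    Dfn (fun v => PairMem (f v) (g v) (h v)) := by
  unfold PairMem
  repeat' with_reducible first
    | exact Pj.id | apply Pj.init | assumption | exact Tm.const _
    | (refine Tm.comp ?_ ?_ <;> [assumption; skip]) | apply Tm.coord
    | apply Dfn.isUPair | apply Dfn.isPair
    | apply Dfn.mem | apply Dfn.eq | apply Dfn.not | apply Dfn.and | apply Dfn.or | apply Dfn.iff
    | apply Dfn.ex

theorem Dfn.tripleMem (hf : Tm f) (hg : Tm g) (hh : Tm h) (hk : Tm k) :
    Dfn (fun v => TripleMem (f v) (g v) (h v) (k v)) := by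
  unfold TripleMem
  repeat' with_reducible first
    | exact Pj.id | apply Pj.init | assumption | exact Tm.const _
    | (refine Tm.comp ?_ ?_ <;> [assumption; skip]) | apply Tm.coord
    | apply Dfn.isUPair | apply Dfn.isPair | apply Dfn.pairMem
    | apply Dfn.mem | apply Dfn.eq | apply Dfn.not | apply Dfn.and | apply Dfn.or | apply Dfn.iff
    | apply Dfn.ex

end Predicates

section Forcing

variable (P : ForcingPoset M) {f g h : (Fin n → M) → M}

theorem Dfn.le (hf : Tm f) (hg : Tm g) : Dfn (fun v => P.Le (f v) (g v)) :=
  (Dfn.mem hf (Tm.const _)).and ((Dfn.mem hg (Tm.const _)).and (Dfn.pairMem hf hg (Tm.const _)))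

theorem Dfn.nameClosed (hf : Tm f) :
    Dfn (fun v => P.NameClosed (f v)) := by
  unfold ForcingPoset.NameClosed
  repeat' with_reducible first
    | exact Pj.id | apply Pj.init | assumption | exact Tm.const _
    | (refine Tm.comp ?_ ?_ <;> [assumption; skip]) | apply Tm.coord
    | apply Dfn.isUPair | apply Dfn.isPair | apply Dfn.pairMem | apply Dfn.tripleMem | apply Dfn.le
    | apply Dfn.mem | apply Dfn.eq | apply Dfn.not | apply Dfn.and | apply Dfn.or | apply Dfn.iff
    | apply Dfn.ex | apply Dfn.imp | apply Dfn.all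

theorem Dfn.isName (hf : Tm f) :
    Dfn (fun v => P.IsName (f v)) := by
  unfold ForcingPoset.IsName
  repeat' with_reducible first
    | exact Pj.id | apply Pj.init | assumption | exact Tm.const _
    | (refine Tm.comp ?_ ?_ <;> [assumption; skip]) | apply Tm.coord
    | apply Dfn.isUPair | apply Dfn.isPair | apply Dfn.pairMem | apply Dfn.tripleMem | apply Dfn.le | apply Dfn.nameClosed
    | apply Dfn.mem | apply Dfn.eq | apply Dfn.not | apply Dfn.and | apply Dfn.or | apply Dfn.iff
    | apply Dfn.ex

theorem Dfn.forcesEq (hf : Tm f) (hg : Tm g) (hh : Tm h) :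
    Dfn (fun v => P.ForcesEq (f v) (g v) (h v)) := by
  unfold ForcingPoset.ForcesEq ForcingPoset.EqClause ForcingPoset.DenseBelow
  repeat' with_reducible first
    | exact Pj.id | apply Pj.init | assumption | exact Tm.const _
    | (refine Tm.comp ?_ ?_ <;> [assumption; skip]) | apply Tm.coord
    | apply Dfn.isUPair | apply Dfn.isPair | apply Dfn.pairMem | apply Dfn.tripleMem | apply Dfn.le | apply Dfn.nameClosed | apply Dfn.isName
    | apply Dfn.mem | apply Dfn.eq | apply Dfn.not | apply Dfn.and | apply Dfn.or | apply Dfn.iff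
    | apply Dfn.ex | apply Dfn.imp | apply Dfn.all

theorem Dfn.forcesMem (hf : Tm f) (hg : Tm g) (hh : Tm h) :
    Dfn (fun v => P.ForcesMem (f v) (g v) (h v)) := by
  unfold ForcingPoset.ForcesMem ForcingPoset.DenseBelow
  repeat' with_reducible first
    | exact Pj.id | apply Pj.init | assumption | exact Tm.const _
    | (refine Tm.comp ?_ ?_ <;> [assumption; skip]) | apply Tm.coord
    | apply Dfn.isUPair | apply Dfn.isPair | apply Dfn.pairMem | apply Dfn.tripleMem | apply Dfn.le | apply Dfn.nameClosed | apply Dfn.isName | apply Dfn.forcesEq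
    | apply Dfn.mem | apply Dfn.eq | apply Dfn.not | apply Dfn.and | apply Dfn.or | apply Dfn.iff
    | apply Dfn.ex | apply Dfn.imp | apply Dfn.all

end Forcing

end Definability

/-! ### Elementary set theory inside a model of ZF. -/

section SetTheory

variable {M : Type u} [setLang.Structure M]

theorem ModelsZF.exists_sep (hM : ModelsZF M) {R : M → Prop}
    (hR : Dfn (fun v : Fin 1 → M => R (v 0))) (a : M) : ∃ b, ∀ x, x ∈ₘ b ↔ x ∈ₘ a ∧ R x := by
  obtain ⟨φ, hφ⟩ := hR
  obtain ⟨b, hb⟩ := hM.separation φ a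
  exact ⟨b, fun x => by rw [hb, hφ]; rfl⟩

/-- Foundation applied to the definable subset of `a` cut out by `R`. Induction on names and the
choice of a least ordinal both rest on this form. -/
theorem ModelsZF.exists_minimal (hM : ModelsZF M) {R : M → Prop}
    (hR : Dfn (fun v : Fin 1 → M => R (v 0))) {a x : M} (hx : x ∈ₘ a) (hRx : R x) :
    ∃ y, y ∈ₘ a ∧ R y ∧ ∀ z, z ∈ₘ y → z ∈ₘ a → ¬ R z := by
  obtain ⟨b, hb⟩ := hM.exists_sep hR a
  obtain ⟨y, hy, hmin⟩ := hM.foundation b ⟨x, (hb x).2 ⟨hx, hRx⟩⟩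
  exact ⟨y, ((hb y).1 hy).1, ((hb y).1 hy).2, fun z hz hza hRz => hmin z hz ((hb z).2 ⟨hza, hRz⟩)⟩

theorem ModelsZF.exists_union (hM : ModelsZF M) (a b : M) : ∃ c, ∀ x, x ∈ₘ c ↔ x ∈ₘ a ∨ x ∈ₘ b := by
  obtain ⟨w, hw⟩ := hM.pairing a b
  obtain ⟨u, hu⟩ := hM.union w
  refine ⟨u, fun x => ?_⟩
  rw [hu]
  constructor
  · rintro ⟨y, hy, hx⟩
    rcases (hw y).1 hy with rfl | rfl
    exacts [Or.inl hx, Or.inr hx]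
  · rintro (hx | hx)
    exacts [⟨a, (hw a).2 (Or.inl rfl), hx⟩, ⟨b, (hw b).2 (Or.inr rfl), hx⟩]

theorem ModelsZF.exists_insert (hM : ModelsZF M) (a b : M) : ∃ c, ∀ x, x ∈ₘ c ↔ x ∈ₘ a ∨ x = b := by
  obtain ⟨w, hw⟩ := hM.pairing b b
  obtain ⟨c, hc⟩ := hM.exists_union a w
  exact ⟨c, fun x => by rw [hc, hw, or_self]⟩

theorem ModelsZF.exists_isPair (hM : ModelsZF M) (x y : M) : ∃ z, IsPair z x y := by
  obtain ⟨a, ha⟩ := hM.pairing x x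
  obtain ⟨b, hb⟩ := hM.pairing x y
  obtain ⟨z, hz⟩ := hM.pairing a b
  exact ⟨z, a, b, ha, hb, hz⟩

theorem IsUPair.unique (hM : ModelsZF M) {z z' x y : M} (h : IsUPair z x y) (h' : IsUPair z' x y) :
    z = z' :=
  hM.extensionality _ _ fun t => (h t).trans (h' t).symm

theorem IsPair.unique (hM : ModelsZF M) {z z' x y : M} (h : IsPair z x y) (h' : IsPair z' x y) :
    z = z' := by
  obtain ⟨a, b, ha, hb, hz⟩ := h
  obtain ⟨a', b', ha', hb', hz'⟩ := h'
  obtain rfl := ha.unique hM ha'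
  obtain rfl := hb.unique hM hb'
  exact hz.unique hM hz'

theorem IsPair.inj {z x y x' y' : M} (h : IsPair z x y) (h' : IsPair z x' y') : x = x' ∧ y = y' := by
  obtain ⟨a, b, ha, hb, hz⟩ := h
  obtain ⟨a', b', ha', hb', hz'⟩ := h'
  have hx : x = x' := by
    have h1 : a' ∈ₘ z := (hz' _).2 (Or.inl rfl)
    have h2 : x ∈ₘ a' := by
      rcases (hz _).1 h1 with rfl | rfl
      exacts [(ha _).2 (Or.inl rfl), (hb _).2 (Or.inl rfl)]
    simpa using (ha' _).1 h2
  subst hx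
  refine ⟨rfl, ?_⟩
  -- Used in both directions, `key` also settles the degenerate case where `y` or `y'` equals `x`.
  have key : ∀ {a b a' b' y y' : M}, IsUPair a x x → IsUPair b x y → IsUPair z a b →
      IsUPair a' x x → IsUPair b' x y' → IsUPair z a' b' → y = x ∨ y = y' := by
    intro a b a' b' y y' _ hb hz ha' hb' hz'
    have hy : y ∈ₘ b := (hb _).2 (Or.inr rfl)
    rcases (hz' _).1 ((hz b).2 (Or.inr rfl)) with rfl | rfl
    · exact Or.inl (by simpa using (ha' _).1 hy)
    · exact (hb' _).1 hy
  rcases key ha hb hz ha' hb' hz' with h1 | h1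
  · rcases key ha' hb' hz' ha hb hz with h2 | h2
    exacts [h1.trans h2.symm, h2.symm]
  · exact h1

theorem PairMem.of_isPair (hM : ModelsZF M) {x y z r : M} (h : PairMem x y r) (hz : IsPair z x y) :
    z ∈ₘ r := by
  obtain ⟨z', hz', h⟩ := h
  rwa [hz.unique hM hz']

/-- Some set contains all pairs of elements of `a`. -/
theorem ModelsZF.exists_pairs (hM : ModelsZF M) (a : M) :
    ∃ b, ∀ x y z, x ∈ₘ a → y ∈ₘ a → IsPair z x y → z ∈ₘ b := by
  obtain ⟨c, hc⟩ := hM.powerset a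
  obtain ⟨b, hb⟩ := hM.powerset c
  refine ⟨b, ?_⟩
  rintro x y z hx hy ⟨s, t, hs, ht, hz⟩
  refine (hb z).2 fun w hw => (hc w).2 fun v hv => ?_
  rcases (hz w).1 hw with rfl | rfl
  · rcases (hs v).1 hv with rfl | rfl <;> exact hx
  · rcases (ht v).1 hv with rfl | rfl
    exacts [hx, hy]

/-- Some set contains all triples with components in `a`. -/
theorem ModelsZF.exists_triples (hM : ModelsZF M) (a : M) :
    ∃ b, ∀ x y z w t, x ∈ₘ a → y ∈ₘ a → z ∈ₘ a → IsPair w y z → IsPair t x w → t ∈ₘ b := by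
  obtain ⟨c, hc⟩ := hM.exists_pairs a
  obtain ⟨d, hd⟩ := hM.exists_union a c
  obtain ⟨b, hb⟩ := hM.exists_pairs d
  exact ⟨b, fun x y z w t hx hy hz hw ht =>
    hb x w t ((hd x).2 (Or.inl hx)) ((hd w).2 (Or.inr (hc y z w hy hz hw))) ht⟩

/-- Any two elements of an ordinal are comparable. -/
theorem IsOrd.trichotomy (hM : ModelsZF M) {κ : M} (hκ : IsOrd κ) {x y : M} (hx : x ∈ₘ κ)
    (hy : y ∈ₘ κ) : x ∈ₘ y ∨ x = y ∨ y ∈ₘ x := by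
  by_contra hxy
  have hD : ∀ {n : ℕ} {f g : (Fin n → M) → M}, Tm f → Tm g →
      Dfn (fun v => ¬ (f v ∈ₘ g v ∨ f v = g v ∨ g v ∈ₘ f v)) := fun hf hg =>
    ((Dfn.mem hf hg).or ((Dfn.eq hf hg).or (Dfn.mem hg hf))).not
  -- Take `x` minimal among the elements incomparable to something, then `y` minimal among those
  -- incomparable to this `x`. Minimality makes `x` and `y` have the same elements.
  obtain ⟨x, hx, ⟨y, hy, hxy⟩, hxmin⟩ := hM.exists_minimal
    (R := fun x => ∃ y, y ∈ₘ κ ∧ ¬ (x ∈ₘ y ∨ x = y ∨ y ∈ₘ x))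
    (Dfn.ex ((Dfn.mem (Tm.coord Pj.id _) (Tm.const _)).and
      (hD (Tm.coord Pj.id.init 0) (Tm.coord Pj.id _)))) hx ⟨y, hy, hxy⟩
  obtain ⟨y, hy, hxy, hymin⟩ := hM.exists_minimal
    (R := fun y => ¬ (x ∈ₘ y ∨ x = y ∨ y ∈ₘ x))
    (hD (Tm.const x) (Tm.coord Pj.id 0)) hy hxy
  refine hxy (Or.inr (Or.inl (hM.extensionality x y fun z => ⟨fun hz => ?_, fun hz => ?_⟩)))
  · have h1 : z ∈ₘ y ∨ z = y ∨ y ∈ₘ z := by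
      by_contra h1
      exact hxmin z hz (hκ.1 x hx z hz) ⟨y, hy, h1⟩
    rcases h1 with h1 | rfl | h1
    · exact h1
    · exact absurd (Or.inr (Or.inr hz)) hxy
    · exact absurd (Or.inr (Or.inr (hκ.2 x hx z hz y h1))) hxy
  · have h1 : x ∈ₘ z ∨ x = z ∨ z ∈ₘ x := by
      by_contra h1
      exact hymin z hz (hκ.1 y hy z hz) h1
    rcases h1 with h1 | rfl | h1
    · exact absurd (Or.inl (hκ.2 y hy z hz x h1)) hxy
    · exact absurd (Or.inl hz) hxy
    · exact h1

end SetTheory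

/-! ### Density, names and induction on names. -/

namespace ForcingPoset

variable {M : Type u} [setLang.Structure M] (P : ForcingPoset M)

theorem Le.refl {P : ForcingPoset M} {p : M} (hp : p ∈ₘ P.carrier) : P.Le p p := ⟨hp, hp, P.refl p hp⟩

theorem Le.trans {P : ForcingPoset M} {p q r : M} (h : P.Le p q) (h' : P.Le q r) : P.Le p r :=
  ⟨h.1, h'.2.1, P.trans _ _ _ h.1 h.2.1 h'.2.1 h.2.2 h'.2.2⟩

theorem DenseBelow.mono {P : ForcingPoset M} {D : M → Prop} {p q : M} (h : P.DenseBelow D p)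
    (hqp : P.Le q p) : P.DenseBelow D q :=
  fun r hr => h r (hr.trans hqp)

theorem DenseBelow.imp {P : ForcingPoset M} {D E : M → Prop} {p : M} (h : P.DenseBelow D p)
    (hDE : ∀ q, P.Le q p → D q → E q) : P.DenseBelow E p := fun r hr => by
  obtain ⟨q, hq, hD⟩ := h r hr
  exact ⟨q, hq, hDE q (hq.trans hr) hD⟩

theorem DenseBelow.bind {P : ForcingPoset M} {D : M → Prop} {p : M}
    (h : P.DenseBelow (P.DenseBelow D) p) : P.DenseBelow D p := fun r hr => by
  obtain ⟨q, hq, hD⟩ := h r hr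
  obtain ⟨q', hq', hD'⟩ := hD q (Le.refl hq.1)
  exact ⟨q', hq'.trans hq, hD'⟩

theorem DenseBelow.of_forall {P : ForcingPoset M} {D : M → Prop} {p : M}
    (h : ∀ q, P.Le q p → D q) : P.DenseBelow D p := fun r hr => ⟨r, Le.refl hr.1, h r hr⟩

theorem NameClosed.of_pairMem {P : ForcingPoset M} {T a s π : M}
    (hT : P.NameClosed T) (ha : a ∈ₘ T) (h : PairMem s π a) : s ∈ₘ P.carrier ∧ π ∈ₘ T := by
  obtain ⟨z, hz, hza⟩ := h
  obtain ⟨s', π', hs, hπ, hz'⟩ := hT a ha z hza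
  obtain ⟨rfl, rfl⟩ := hz.inj hz'
  exact ⟨hs, hπ⟩

theorem NameClosed.of_union {P : ForcingPoset M} {T T' U : M} (hT : P.NameClosed T)
    (hT' : P.NameClosed T') (hU : ∀ x, x ∈ₘ U ↔ x ∈ₘ T ∨ x ∈ₘ T') : P.NameClosed U := by
  intro y hy z hz
  rcases (hU y).1 hy with hy | hy
  · obtain ⟨s, π, hs, hπ, h⟩ := hT y hy z hz
    exact ⟨s, π, hs, (hU π).2 (Or.inl hπ), h⟩
  · obtain ⟨s, π, hs, hπ, h⟩ := hT' y hy z hz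
    exact ⟨s, π, hs, (hU π).2 (Or.inr hπ), h⟩

theorem IsName.of_pairMem {P : ForcingPoset M} {a s π : M}
    (ha : P.IsName a) (h : PairMem s π a) : P.IsName π := by
  obtain ⟨T, haT, hT⟩ := ha
  exact ⟨T, (hT.of_pairMem haT h).2, hT⟩

theorem exists_nameClosed₂ (hM : ModelsZF M) {a b : M} (ha : P.IsName a) (hb : P.IsName b) :
    ∃ T, a ∈ₘ T ∧ b ∈ₘ T ∧ P.NameClosed T := by
  obtain ⟨T, haT, hT⟩ := ha
  obtain ⟨T', hbT, hT'⟩ := hb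
  obtain ⟨U, hU⟩ := hM.exists_union T T'
  exact ⟨U, (hU a).2 (Or.inl haT), (hU b).2 (Or.inr hbT), hT.of_union hT' hU⟩

/-- Induction on names, for definable properties. -/
theorem IsName.induction (hM : ModelsZF M) {P : ForcingPoset M} {R : M → Prop}
    (hR : ∀ {n : ℕ} {f : (Fin n → M) → M}, Tm f → Dfn (fun v => R (f v)))
    (ih : ∀ a, P.IsName a → (∀ s π, PairMem s π a → R π) → R a) {a : M} (ha : P.IsName a) : R a := by
  by_contra hRa
  obtain ⟨T, haT, hT⟩ := ha
  -- A name π in the domain of m lies three membership steps below it: π ∈ {s, π} ∈ (s, π) ∈ m.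
  -- Foundation must therefore be applied to a set that also contains the intermediate sets, found
  -- in `U` and `V`.
  obtain ⟨U, hU⟩ := hM.union T
  obtain ⟨V, hV⟩ := hM.union U
  obtain ⟨W, hW⟩ := hM.exists_union U V
  obtain ⟨X, hX⟩ := hM.exists_union T W
  -- bad names, together with the sets that lie between a bad name and the names in its domain
  let B₀ : M → Prop := fun x => x ∈ₘ T ∧ ¬ R x
  let B₁ : M → Prop := fun x => x ∈ₘ V ∧ ∃ y, y ∈ₘ x ∧ B₀ y
  let B₂ : M → Prop := fun x => x ∈ₘ U ∧ ∃ y, y ∈ₘ x ∧ B₁ y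
  have h₀ : ∀ {n : ℕ} {f : (Fin n → M) → M}, Tm f → Dfn (fun v => B₀ (f v)) := fun hf =>
    (Dfn.mem hf (Tm.const _)).and (hR hf).not
  have h₁ : ∀ {n : ℕ} {f : (Fin n → M) → M}, Tm f → Dfn (fun v => B₁ (f v)) := fun hf =>
    (Dfn.mem hf (Tm.const _)).and (Dfn.ex ((Dfn.mem (Tm.coord Pj.id _) (hf.comp Pj.id.init)).and
      (h₀ (Tm.coord Pj.id _))))
  have h₂ : ∀ {n : ℕ} {f : (Fin n → M) → M}, Tm f → Dfn (fun v => B₂ (f v)) := fun hf =>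
    (Dfn.mem hf (Tm.const _)).and (Dfn.ex ((Dfn.mem (Tm.coord Pj.id _) (hf.comp Pj.id.init)).and
      (h₁ (Tm.coord Pj.id _))))
  have hTm : Tm (fun v : Fin 1 → M => v 0) := Tm.coord Pj.id 0
  obtain ⟨m, -, hm, hmin⟩ := hM.exists_minimal (R := fun x => B₀ x ∨ B₁ x ∨ B₂ x)
    ((h₀ hTm).or ((h₁ hTm).or (h₂ hTm))) ((hX a).2 (Or.inl haT)) (Or.inl ⟨haT, hRa⟩)
  rcases hm with hm | ⟨-, y, hy, hB⟩ | ⟨-, y, hy, hB⟩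
  · refine hm.2 (ih m ⟨T, hm.1, hT⟩ fun s π hπ => ?_)
    have hπT := (hT.of_pairMem hm.1 hπ).2
    obtain ⟨z, ⟨b, c, hb, hc, hz⟩, hzm⟩ := hπ
    by_contra hRπ
    have hzU : z ∈ₘ U := (hU z).2 ⟨m, hm.1, hzm⟩
    have hcz : c ∈ₘ z := (hz c).2 (Or.inr rfl)
    exact hmin z hzm ((hX z).2 (Or.inr ((hW z).2 (Or.inl hzU))))
      (Or.inr (Or.inr ⟨hzU, c, hcz, (hV c).2 ⟨z, hzU, hcz⟩, π, (hc π).2 (Or.inr rfl), hπT, hRπ⟩))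
  · exact hmin y hy ((hX y).2 (Or.inl hB.1)) (Or.inl hB)
  · exact hmin y hy ((hX y).2 (Or.inr ((hW y).2 (Or.inr hB.1)))) (Or.inr (Or.inl hB))

/-! ### Forcing equalities -/

/-- `A` satisfies the recursion clause for forced equality on `T`. -/
def IsEqRel (T A : M) : Prop :=
  ∀ q a b, q ∈ₘ P.carrier → a ∈ₘ T → b ∈ₘ T →
    (TripleMem q a b A ↔ P.EqClause (fun r π π' => TripleMem r π π' A) q a b)

/-- Monotonicity in `S`, needed only at names in the two domains. It drives the fixed-point
construction and lets inductive hypotheses be substituted into the clause. -/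
theorem EqClause.imp {P : ForcingPoset M} {S S' : M → M → M → Prop} {p a b : M}
    (h : P.EqClause S p a b)
    (hSS' : ∀ q s π s' π', q ∈ₘ P.carrier → PairMem s π a → PairMem s' π' b → S q π π' → S' q π π') :
    P.EqClause S' p a b := by
  refine ⟨fun s π hs => (h.1 s π hs).imp fun q _ hq hqs => ?_,
    fun s' π' hs' => (h.2 s' π' hs').imp fun q _ hq hqs => ?_⟩
  · obtain ⟨s', π', h1, h2, h3⟩ := hq hqs
    exact ⟨s', π', h1, h2, hSS' q s π s' π' hqs.1 hs h1 h3⟩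
  · obtain ⟨s, π, h1, h2, h3⟩ := hq hqs
    exact ⟨s, π, h1, h2, hSS' q s π s' π' hqs.1 h1 hs' h3⟩

theorem EqClause.mono {P : ForcingPoset M} {S : M → M → M → Prop} {p q a b : M}
    (h : P.EqClause S p a b) (hqp : P.Le q p) : P.EqClause S q a b :=
  ⟨fun s π hs => (h.1 s π hs).mono hqp, fun s π hs => (h.2 s π hs).mono hqp⟩

theorem EqClause.of_denseBelow {P : ForcingPoset M} {S : M → M → M → Prop} {p a b : M}
    (h : P.DenseBelow (fun q => P.EqClause S q a b) p) : P.EqClause S p a b :=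
  ⟨fun s π hs => (h.imp fun _ _ hq => hq.1 s π hs).bind,
    fun s π hs => (h.imp fun _ _ hq => hq.2 s π hs).bind⟩

theorem EqClause.symm {P : ForcingPoset M} {S : M → M → M → Prop} {p a b : M}
    (h : P.EqClause S p a b) : P.EqClause (fun q π π' => S q π' π) p b a :=
  ⟨h.2, h.1⟩

theorem tripleMem_iff (hM : ModelsZF M) {x y z w t A : M} (hw : IsPair w y z) (ht : IsPair t x w) :
    TripleMem x y z A ↔ t ∈ₘ A := by
  constructor
  · rintro ⟨w', hw', h⟩
    obtain rfl := hw.unique hM hw'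
    exact h.of_isPair hM ht
  · exact fun h => ⟨w, hw, t, ht, h⟩

/-- The recursion clause has a solution on every closed set of names: the greatest fixed point. -/
theorem exists_isEqRel (hM : ModelsZF M) {T : M} (hT : P.NameClosed T) : ∃ A, P.IsEqRel T A := by
  obtain ⟨C, hC⟩ := hM.exists_union P.carrier T
  obtain ⟨U, hU⟩ := hM.exists_triples C
  obtain ⟨W, hW⟩ := hM.powerset U
  -- Good sets are the post-fixed points of the clause. `A` will be the union of the good subsets of
  -- `U`, and is good by monotonicity.
  let Good : M → Prop := fun B => ∀ q a b, q ∈ₘ P.carrier → a ∈ₘ T → b ∈ₘ T → TripleMem q a b B →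
    P.EqClause (fun r π π' => TripleMem r π π' B) q a b
  have hGood : Dfn (fun v : Fin 2 → M => Good (v (Fin.last 1))) := by
    simp only [Good, EqClause, DenseBelow]
    repeat' with_reducible first
      | exact Pj.id | apply Pj.init | exact Tm.const _ | apply Tm.coord
      | apply Dfn.pairMem | apply Dfn.tripleMem | apply Dfn.le
      | apply Dfn.mem | apply Dfn.and | apply Dfn.ex | apply Dfn.imp | apply Dfn.all
  obtain ⟨A, hA⟩ := hM.exists_sep (R := fun t => ∃ B, B ∈ₘ W ∧ Good B ∧ t ∈ₘ B)
    (Dfn.ex ((Dfn.mem (Tm.coord Pj.id _) (Tm.const _)).and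
      (hGood.and (Dfn.mem (Tm.coord Pj.id.init _) (Tm.coord Pj.id _))))) U
  have hsub : ∀ {B q a b}, q ∈ₘ P.carrier → a ∈ₘ T → b ∈ₘ T → B ∈ₘ W → Good B →
      TripleMem q a b B → TripleMem q a b A := by
    intro B q a b hq ha hb hB hG h
    obtain ⟨w, hw, t, ht, h⟩ := h
    exact ⟨w, hw, t, ht, (hA t).2 ⟨(hW B).1 hB t h, B, hB, hG, h⟩⟩
  have hAW : A ∈ₘ W := (hW A).2 fun t ht => ((hA t).1 ht).1
  have hAGood : Good A := by
    intro q a b hq ha hb h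
    obtain ⟨w, hw, t, ht, h⟩ := h
    obtain ⟨-, B, hB, hG, h⟩ := (hA t).1 h
    exact (hG q a b hq ha hb ⟨w, hw, t, ht, h⟩).imp fun q s π s' π' hq hs hs' h =>
      hsub hq (hT.of_pairMem ha hs).2 (hT.of_pairMem hb hs').2 hB hG h
  refine ⟨A, fun q a b hq ha hb => ⟨hAGood q a b hq ha hb, fun hcl => ?_⟩⟩
  obtain ⟨w, hw⟩ := hM.exists_isPair a b
  obtain ⟨t, ht⟩ := hM.exists_isPair q w
  have htU : t ∈ₘ U := hU q a b w t ((hC q).2 (Or.inl hq)) ((hC a).2 (Or.inr ha))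
    ((hC b).2 (Or.inr hb)) hw ht
  -- If the clause holds at the triple `t`, then A ∪ {t} is still good, so it is contained in `A`.
  obtain ⟨B, hB⟩ := hM.exists_insert A t
  have hAB : ∀ {x y z}, TripleMem x y z A → TripleMem x y z B := by
    rintro x y z ⟨w, hw, t, ht, h⟩
    exact ⟨w, hw, t, ht, (hB t).2 (Or.inl h)⟩
  have hBW : B ∈ₘ W := (hW B).2 fun x hx => by
    rcases (hB x).1 hx with hx | rfl
    exacts [((hA x).1 hx).1, htU]
  refine hsub hq ha hb hBW ?_ ((tripleMem_iff hM hw ht).2 ((hB t).2 (Or.inr rfl)))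
  intro q' a' b' hq' ha' hb' h
  suffices h' : P.EqClause (fun r π π' => TripleMem r π π' A) q' a' b' from
    h'.imp fun _ _ _ _ _ _ _ _ h => hAB h
  obtain ⟨w', hw', t', ht', h⟩ := h
  rcases (hB t').1 h with h | rfl
  · exact hAGood q' a' b' hq' ha' hb' ⟨w', hw', t', ht', h⟩
  · obtain ⟨rfl, rfl⟩ := ht.inj ht'
    obtain ⟨rfl, rfl⟩ := hw.inj hw'
    exact hcl

variable {P}

/-- Two solutions of the recursion clause agree. -/
theorem IsEqRel.unique (hM : ModelsZF M) {T T' A A' : M} (hT : P.NameClosed T)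
    (hT' : P.NameClosed T') (hA : P.IsEqRel T A) (hA' : P.IsEqRel T' A') {q a b : M}
    (hq : q ∈ₘ P.carrier) (ha : a ∈ₘ T) (ha' : a ∈ₘ T') (hb : b ∈ₘ T) (hb' : b ∈ₘ T') :
    TripleMem q a b A ↔ TripleMem q a b A' := by
  refine IsName.induction hM (P := P) (R := fun a => a ∈ₘ T → a ∈ₘ T' → ∀ q b, q ∈ₘ P.carrier →
    b ∈ₘ T → b ∈ₘ T' → (TripleMem q a b A ↔ TripleMem q a b A')) ?_ ?_ ⟨T, ha, hT⟩
    ha ha' q b hq hb hb'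
  · intro n f hf
    repeat' with_reducible first
      | exact Pj.id | apply Pj.init | assumption | exact Tm.const _
      | (refine Tm.comp ?_ ?_ <;> [assumption; skip]) | apply Tm.coord
      | apply Dfn.tripleMem | apply Dfn.mem | apply Dfn.iff | apply Dfn.imp | apply Dfn.all
  · intro a _ ih ha ha' q b hq hb hb'
    rw [hA q a b hq ha hb, hA' q a b hq ha' hb']
    constructor
    · exact fun h => h.imp fun q s π s' π' hq hs hs' h =>
        (ih s π hs (hT.of_pairMem ha hs).2 (hT'.of_pairMem ha' hs).2 q π' hq
          (hT.of_pairMem hb hs').2 (hT'.of_pairMem hb' hs').2).1 h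
    · exact fun h => h.imp fun q s π s' π' hq hs hs' h =>
        (ih s π hs (hT.of_pairMem ha hs).2 (hT'.of_pairMem ha' hs).2 q π' hq
          (hT.of_pairMem hb hs').2 (hT'.of_pairMem hb' hs').2).2 h

theorem forcesEq_iff_tripleMem (hM : ModelsZF M) {T A : M} (hT : P.NameClosed T)
    (hA : P.IsEqRel T A) {q a b : M} (hq : q ∈ₘ P.carrier) (ha : a ∈ₘ T) (hb : b ∈ₘ T) :
    P.ForcesEq q a b ↔ TripleMem q a b A := by
  constructor
  · rintro ⟨T', A', ha', hb', hT', hA', h⟩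
    exact (IsEqRel.unique hM hT hT' hA hA' hq ha ha' hb hb').2 h
  · exact fun h => ⟨T, A, ha, hb, hT, hA, h⟩

/-- By uniqueness of solutions the choice of `T` and `A` in `ForcesEq` is immaterial, so the clause
passes from a local solution to the global relation. -/
theorem forcesEq_iff (hM : ModelsZF M) {q a b : M} (hq : q ∈ₘ P.carrier) (ha : P.IsName a)
    (hb : P.IsName b) : P.ForcesEq q a b ↔ P.EqClause P.ForcesEq q a b := by
  obtain ⟨T, haT, hbT, hT⟩ := P.exists_nameClosed₂ hM ha hb
  obtain ⟨A, hA⟩ := P.exists_isEqRel hM hT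
  rw [forcesEq_iff_tripleMem hM hT hA hq haT hbT, hA q a b hq haT hbT]
  constructor
  · exact fun h => h.imp fun q s π s' π' hq hs hs' h => (forcesEq_iff_tripleMem hM hT hA hq
      (hT.of_pairMem haT hs).2 (hT.of_pairMem hbT hs').2).2 h
  · exact fun h => h.imp fun q s π s' π' hq hs hs' h => (forcesEq_iff_tripleMem hM hT hA hq
      (hT.of_pairMem haT hs).2 (hT.of_pairMem hbT hs').2).1 h

theorem ForcesEq.mono (hM : ModelsZF M) {p q a b : M} (ha : P.IsName a) (hb : P.IsName b)
    (h : P.ForcesEq p a b) (hqp : P.Le q p) : P.ForcesEq q a b :=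
  (forcesEq_iff hM hqp.1 ha hb).2 (((forcesEq_iff hM hqp.2.1 ha hb).1 h).mono hqp)

theorem ForcesEq.of_denseBelow (hM : ModelsZF M) {p a b : M} (hp : p ∈ₘ P.carrier)
    (ha : P.IsName a) (hb : P.IsName b) (h : P.DenseBelow (fun q => P.ForcesEq q a b) p) :
    P.ForcesEq p a b :=
  (forcesEq_iff hM hp ha hb).2 (EqClause.of_denseBelow
    (h.imp fun _ hq h => (forcesEq_iff hM hq.1 ha hb).1 h))

theorem ForcesEq.refl (hM : ModelsZF M) {p a : M} (hp : p ∈ₘ P.carrier) (ha : P.IsName a) :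
    P.ForcesEq p a a := by
  refine ha.induction hM (R := fun a => ∀ p, p ∈ₘ P.carrier → P.ForcesEq p a a) (fun hf => Dfn.all
    ((Dfn.mem (Tm.coord Pj.id _) (Tm.const _)).imp (Dfn.forcesEq P (Tm.coord Pj.id _)
      (hf.comp Pj.id.init) (hf.comp Pj.id.init)))) ?_ p hp
  exact fun a ha ih p hp => (forcesEq_iff hM hp ha ha).2
    ⟨fun s π hs => .of_forall fun q _ hqs => ⟨s, π, hs, hqs, ih s π hs q hqs.1⟩,
      fun s π hs => .of_forall fun q _ hqs => ⟨s, π, hs, hqs, ih s π hs q hqs.1⟩⟩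

theorem ForcesEq.symm (hM : ModelsZF M) {p a b : M} (hp : p ∈ₘ P.carrier) (ha : P.IsName a)
    (hb : P.IsName b) (h : P.ForcesEq p a b) : P.ForcesEq p b a := by
  refine ha.induction hM (R := fun a => ∀ p b, p ∈ₘ P.carrier → P.IsName b → P.ForcesEq p a b →
    P.ForcesEq p b a) ?_ ?_ p b hp hb h
  · intro n f hf
    repeat' with_reducible first
      | exact Pj.id | apply Pj.init | assumption | exact Tm.const _
      | (refine Tm.comp ?_ ?_ <;> [assumption; skip]) | apply Tm.coord
      | apply Dfn.forcesEq | apply Dfn.isName | apply Dfn.mem | apply Dfn.imp | apply Dfn.all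
  · intro a ha ih p b hp hb h
    exact (forcesEq_iff hM hp hb ha).2 (((forcesEq_iff hM hp ha hb).1 h).symm.imp
      fun q s π s' π' hq hs hs' h => ih s' π' hs' q π hq (hb.of_pairMem hs) h)

theorem ForcesEq.trans (hM : ModelsZF M) {p a b c : M} (hp : p ∈ₘ P.carrier) (ha : P.IsName a)
    (hb : P.IsName b) (hc : P.IsName c) (hab : P.ForcesEq p a b) (hbc : P.ForcesEq p b c) :
    P.ForcesEq p a c := by
  refine ha.induction hM (R := fun a => ∀ p b c, p ∈ₘ P.carrier → P.IsName b → P.IsName c →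
    P.ForcesEq p a b → P.ForcesEq p b c → P.ForcesEq p a c) ?_ ?_ p b c hp hb hc hab hbc
  · intro n f hf
    repeat' with_reducible first
      | exact Pj.id | apply Pj.init | assumption | exact Tm.const _
      | (refine Tm.comp ?_ ?_ <;> [assumption; skip]) | apply Tm.coord
      | apply Dfn.forcesEq | apply Dfn.isName | apply Dfn.mem | apply Dfn.imp | apply Dfn.all
  · intro a ha ih p b c hp hb hc hab hbc
    have hab := (forcesEq_iff hM hp ha hb).1 hab
    have hbc := (forcesEq_iff hM hp hb hc).1 hbc
    refine (forcesEq_iff hM hp ha hc).2 ⟨fun s π hs => ?_, fun s π hs => ?_⟩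
    · intro r hr
      obtain ⟨r₁, hr₁, h₁⟩ := hab.1 s π hs r hr
      -- Where `r₁` is not below `s`, the density requirement is vacuous at `r₁` itself.
      by_cases hrs : P.Le r₁ s
      swap
      · exact ⟨r₁, hr₁, fun h => absurd h hrs⟩
      obtain ⟨s', π', hs', hrs', h₁⟩ := h₁ hrs
      obtain ⟨r₂, hr₂, h₂⟩ := hbc.1 s' π' hs' r₁ (hr₁.trans hr)
      obtain ⟨s'', π'', hs'', hrs'', h₂⟩ := h₂ (hr₂.trans hrs')
      have hπ' := hb.of_pairMem hs'
      exact ⟨r₂, hr₂.trans hr₁, fun _ => ⟨s'', π'', hs'', hrs'', ih s π hs r₂ π' π'' hr₂.1 hπ'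
        (hc.of_pairMem hs'') (h₁.mono hM (ha.of_pairMem hs) hπ' hr₂) h₂⟩⟩
    · intro r hr
      obtain ⟨r₁, hr₁, h₁⟩ := hbc.2 s π hs r hr
      by_cases hrs : P.Le r₁ s
      swap
      · exact ⟨r₁, hr₁, fun h => absurd h hrs⟩
      obtain ⟨s', π', hs', hrs', h₁⟩ := h₁ hrs
      obtain ⟨r₂, hr₂, h₂⟩ := hab.2 s' π' hs' r₁ (hr₁.trans hr)
      obtain ⟨s'', π'', hs'', hrs'', h₂⟩ := h₂ (hr₂.trans hrs')
      have hπ' := hb.of_pairMem hs'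
      exact ⟨r₂, hr₂.trans hr₁, fun _ => ⟨s'', π'', hs'', hrs'', ih s'' π'' hs'' r₂ π' π hr₂.1 hπ'
        (hc.of_pairMem hs) h₂ (h₁.mono hM hπ' (hc.of_pairMem hs) hr₂)⟩⟩

variable {M : Type u} [setLang.Structure M] {P : ForcingPoset M} {n : ℕ}

/-! ### Forcing memberships -/

theorem ForcesMem.mono {p q a b : M} (h : P.ForcesMem p a b) (hqp : P.Le q p) :
    P.ForcesMem q a b :=
  DenseBelow.mono h hqp

theorem ForcesMem.congr (hM : ModelsZF M) {p a b a' b' : M} (ha : P.IsName a)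
    (hb : P.IsName b) (ha' : P.IsName a') (hb' : P.IsName b') (haa' : P.ForcesEq p a a')
    (hbb' : P.ForcesEq p b b') (h : P.ForcesMem p a b) : P.ForcesMem p a' b' := by
  intro r hr
  obtain ⟨q, hq, s, π, hs, hqs, h⟩ := h r hr
  have hqp := hq.trans hr
  obtain ⟨q', hq', h'⟩ := ((forcesEq_iff hM hr.2.1 hb hb').1 hbb').1 s π hs q hqp
  obtain ⟨s', π', hs', hqs', h'⟩ := h' (hq'.trans hqs)
  have hπ := hb.of_pairMem hs
  have hπ' := hb'.of_pairMem hs'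
  have haa'' := (haa'.mono hM ha ha' (hq'.trans hqp)).symm hM hq'.1 ha ha'
  exact ⟨q', hq'.trans hq, s', π', hs', hqs',
    haa''.trans hM hq'.1 ha' ha hπ' ((h.mono hM ha hπ hq').trans hM hq'.1 ha hπ hπ' h')⟩

/-- A name in the domain of `b`, with a condition below its label, is forced to belong to `b`. -/
theorem ForcesMem.of_pairMem (hM : ModelsZF M) {p a b s : M} (ha : P.IsName a)
    (h : PairMem s a b) (hps : P.Le p s) : P.ForcesMem p a b :=
  .of_forall fun _ hq => ⟨s, a, h, hq.trans hps, .refl hM hq.1 ha⟩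

/-! ### The forcing relation on elements of the model -/

variable (P) in
/-- The value of a term of the forcing language, as an element of `M`. -/
def termEl (xs : Fin n → M) (t : setLang.Term (P.Name ⊕ Fin n)) : M :=
  termVal (Sum.elim (fun a : P.Name => a.1) xs) t

variable (P) in
/-- The forcing relation, with elements of `M` in place of names as values of the variables. -/
def ForcesEl : {n : ℕ} → M → setLang.BoundedFormula P.Name n → (Fin n → M) → Prop
  | _, _, .falsum, _ => False
  | _, p, .equal t₁ t₂, xs => P.ForcesEq p (P.termEl xs t₁) (P.termEl xs t₂)
  | _, p, .rel MemSymb.mem ts, xs => P.ForcesMem p (P.termEl xs (ts 0)) (P.termEl xs (ts 1))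
  | _, p, .imp φ ψ, xs => ∀ q, P.Le q p → ForcesEl q φ xs → ∃ r, P.Le r q ∧ ForcesEl r ψ xs
  | _, p, .all φ, xs => ∀ x, P.IsName x → ForcesEl p φ (Fin.snoc xs x)

theorem val_termVal (xs : Fin n → P.Name) (t : setLang.Term (P.Name ⊕ Fin n)) :
    (termVal (Sum.elim id (fun i => xs i)) t : P.Name).1 = P.termEl (fun i => (xs i).1) t := by
  rcases t with (a | i) | ⟨f, _⟩
  · rfl
  · rfl
  · exact Empty.elim f

/-- Definability concerns tuples of elements of `M`, while `Forces` takes values in the subtype of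
names; this passes between the two. -/
theorem forces_iff_forcesEl (p : M) (φ : setLang.BoundedFormula P.Name n) (xs : Fin n → P.Name) :
    P.Forces p φ xs ↔ P.ForcesEl p φ (fun i => (xs i).1) := by
  induction φ generalizing p with
  | falsum => rfl
  | equal t₁ t₂ => simp only [Forces, ForcesEl, val_termVal]
  | rel R ts =>
    cases R
    simp only [Forces, ForcesEl, ForcesRel, val_termVal]
  | imp φ ψ ihφ ihψ => simp only [Forces, ForcesEl, ihφ, ihψ]
  | @all n φ ih =>
    have key : ∀ x : P.Name, (fun i => ((Fin.snoc xs x : Fin (n + 1) → P.Name) i).1) =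
        (Fin.snoc (fun i => (xs i).1) x.1 : Fin (n + 1) → M) := fun x => by
      funext i
      refine Fin.lastCases ?_ (fun i => ?_) i <;> simp
    simp only [Forces, ForcesEl, ih, key]
    exact ⟨fun h x hx => h ⟨x, hx⟩, fun h x => h x.1 x.2⟩

theorem isName_snoc {xs : Fin n → M} (hxs : ∀ i, P.IsName (xs i)) {x : M} (hx : P.IsName x)
    (i : Fin (n + 1)) : P.IsName ((Fin.snoc xs x : Fin (n + 1) → M) i) := by
  refine Fin.lastCases ?_ (fun i => ?_) i
  · simpa using hx
  · simpa using hxs i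

theorem isName_termEl {xs : Fin n → M} (hxs : ∀ i, P.IsName (xs i))
    (t : setLang.Term (P.Name ⊕ Fin n)) : P.IsName (P.termEl xs t) := by
  rcases t with (a | i) | ⟨f, _⟩
  · exact a.2
  · exact hxs i
  · exact Empty.elim f

theorem tm_termEl {m : ℕ} {xs : (Fin m → M) → Fin n → M} (hxs : ∀ i, Tm (fun v => xs v i))
    (t : setLang.Term (P.Name ⊕ Fin n)) : Tm (fun v => P.termEl (xs v) t) := by
  rcases t with (a | i) | ⟨f, _⟩
  · exact Tm.const a.1
  · exact hxs i
  · exact Empty.elim f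

/-- Definability of the forcing relation. -/
theorem _root_.ZFForcing.Dfn.forcesEl {m : ℕ} {f : (Fin m → M) → M} {xs : (Fin m → M) → Fin n → M}
    (φ : setLang.BoundedFormula P.Name n) (hf : Tm f) (hxs : ∀ i, Tm (fun v => xs v i)) :
    Dfn (fun v => P.ForcesEl (f v) φ (xs v)) := by
  induction φ generalizing m with
  | falsum => exact Dfn.false
  | equal t₁ t₂ => exact Dfn.forcesEq P hf (tm_termEl hxs t₁) (tm_termEl hxs t₂)
  | rel R ts =>
    cases R
    exact Dfn.forcesMem P hf (tm_termEl hxs _) (tm_termEl hxs _)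
  | imp φ ψ ihφ ihψ =>
    refine Dfn.all (Dfn.imp (Dfn.le P (Tm.coord Pj.id _) (hf.comp Pj.id.init)) (Dfn.imp
      (ihφ (Tm.coord Pj.id _) fun i => (hxs i).comp Pj.id.init) (Dfn.ex (Dfn.and
        (Dfn.le P (Tm.coord Pj.id _) (Tm.coord Pj.id.init _))
        (ihψ (Tm.coord Pj.id _) fun i => (hxs i).comp Pj.id.init.init)))))
  | all φ ih =>
    refine Dfn.all (Dfn.imp (Dfn.isName P (Tm.coord Pj.id _))
      (ih (hf.comp Pj.id.init) fun i => ?_))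
    refine Fin.lastCases ?_ (fun i => ?_) i
    · simpa using Tm.coord Pj.id _
    · simpa using (hxs i).comp Pj.id.init

theorem ForcesEl.mono (hM : ModelsZF M) {φ : setLang.BoundedFormula P.Name n} {xs : Fin n → M}
    (hxs : ∀ i, P.IsName (xs i)) {p q : M} (h : P.ForcesEl p φ xs) (hqp : P.Le q p) :
    P.ForcesEl q φ xs := by
  induction φ with
  | falsum => exact h
  | equal t₁ t₂ => exact ForcesEq.mono hM (isName_termEl hxs _) (isName_termEl hxs _) h hqp
  | rel R ts =>
    cases R
    exact ForcesMem.mono h hqp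
  | imp φ ψ _ _ => exact fun r hr => h r (hr.trans hqp)
  | all φ ih => exact fun x hx => ih (isName_snoc hxs hx) (h x hx)

/-- This replaces the gluing of names: θ(τ) need only be checked on a dense set, for one fixed τ. -/
theorem ForcesEl.of_denseBelow (hM : ModelsZF M) {φ : setLang.BoundedFormula P.Name n}
    {xs : Fin n → M} (hxs : ∀ i, P.IsName (xs i)) {p : M} (hp : p ∈ₘ P.carrier)
    (h : P.DenseBelow (fun q => P.ForcesEl q φ xs) p) : P.ForcesEl p φ xs := by
  induction φ with
  | falsum =>
    obtain ⟨q, -, h⟩ := h p (Le.refl hp)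
    exact h
  | equal t₁ t₂ => exact ForcesEq.of_denseBelow hM hp (isName_termEl hxs _) (isName_termEl hxs _) h
  | rel R ts =>
    cases R
    exact DenseBelow.bind h
  | imp φ ψ _ _ =>
    intro q hq hφ
    obtain ⟨r, hr, h⟩ := h q hq
    obtain ⟨r', hr', h⟩ := h r (Le.refl hr.1) (hφ.mono hM hxs hr)
    exact ⟨r', hr'.trans hr, h⟩
  | all φ ih => exact fun x hx => ih (isName_snoc hxs hx) (h.imp fun _ _ h => h x hx)

theorem ForcesEl.congr (hM : ModelsZF M) {φ : setLang.BoundedFormula P.Name n} {xs ys : Fin n → M}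
    (hxs : ∀ i, P.IsName (xs i)) (hys : ∀ i, P.IsName (ys i)) {p : M} (hp : p ∈ₘ P.carrier)
    (hxy : ∀ i, P.ForcesEq p (xs i) (ys i)) (h : P.ForcesEl p φ xs) : P.ForcesEl p φ ys := by
  have ht : ∀ {n : ℕ} {xs ys : Fin n → M} {p}, p ∈ₘ P.carrier → (∀ i, P.ForcesEq p (xs i) (ys i)) →
      ∀ t, P.ForcesEq p (P.termEl xs t) (P.termEl ys t) := by
    intro n xs ys p hp hxy t
    rcases t with (a | i) | ⟨f, _⟩
    · exact .refl hM hp a.2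
    · exact hxy i
    · exact Empty.elim f
  induction φ generalizing p with
  | falsum => exact h
  | equal t₁ t₂ =>
    have hx₁ := isName_termEl hxs t₁
    have hx₂ := isName_termEl hxs t₂
    have hy₁ := isName_termEl hys t₁
    have hy₂ := isName_termEl hys t₂
    exact ((ht hp hxy t₁).symm hM hp hx₁ hy₁).trans hM hp hy₁ hx₁ hy₂
      (ForcesEq.trans hM hp hx₁ hx₂ hy₂ h (ht hp hxy t₂))
  | rel R ts =>
    cases R
    exact ForcesMem.congr hM (isName_termEl hxs _) (isName_termEl hxs _) (isName_termEl hys _)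
      (isName_termEl hys _) (ht hp hxy _) (ht hp hxy _) h
  | imp φ ψ ihφ ihψ =>
    intro q hq hφ
    have hxy' : ∀ i, P.ForcesEq q (xs i) (ys i) := fun i => (hxy i).mono hM (hxs i) (hys i) hq
    -- The antecedent is transported from `ys` back to `xs`, hence the symmetry of forced equality.
    obtain ⟨r, hr, h⟩ := h q hq
      (ihφ hys hxs hq.1 (fun i => (hxy' i).symm hM hq.1 (hxs i) (hys i)) hφ)
    exact ⟨r, hr, ihψ hxs hys hr.1 (fun i => (hxy' i).mono hM (hxs i) (hys i) hr) h⟩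
  | all φ ih =>
    intro x hx
    refine ih (isName_snoc hxs hx) (isName_snoc hys hx) hp (fun i => ?_) (h x hx)
    refine Fin.lastCases ?_ (fun i => ?_) i
    · simpa using ForcesEq.refl hM hp hx
    · simpa using hxy i

/-! ### Forcing and the logical connectives -/

theorem forcesEl_imp (hM : ModelsZF M) {φ ψ : setLang.BoundedFormula P.Name n} {xs : Fin n → M}
    (hxs : ∀ i, P.IsName (xs i)) {p : M} :
    P.ForcesEl p (φ.imp ψ) xs ↔ ∀ q, P.Le q p → P.ForcesEl q φ xs → P.ForcesEl q ψ xs := by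
  constructor
  · intro h q hq hφ
    exact .of_denseBelow hM hxs hq.1 fun r hr => h r (hr.trans hq) (hφ.mono hM hxs hr)
  · exact fun h q hq hφ => ⟨q, Le.refl hq.1, h q hq hφ⟩

theorem forcesEl_not {φ : setLang.BoundedFormula P.Name n} {xs : Fin n → M} {p : M} :
    P.ForcesEl p φ.not xs ↔ ∀ q, P.Le q p → ¬ P.ForcesEl q φ xs := by
  constructor
  · intro h q hq hφ
    obtain ⟨_, _, h⟩ := h q hq hφ
    exact h
  · exact fun h q hq hφ => absurd hφ (h q hq)

theorem forcesEl_inf (hM : ModelsZF M) {φ ψ : setLang.BoundedFormula P.Name n} {xs : Fin n → M}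
    (hxs : ∀ i, P.IsName (xs i)) {p : M} (hp : p ∈ₘ P.carrier) :
    P.ForcesEl p (φ ⊓ ψ) xs ↔ P.ForcesEl p φ xs ∧ P.ForcesEl p ψ xs := by
  -- Conjunction is coded as ¬(φ → ¬ψ), which directly gives only a dense set of conditions forcing
  -- both.
  change P.ForcesEl p (φ.imp ψ.not).not xs ↔ _
  simp only [forcesEl_not, forcesEl_imp hM hxs]
  constructor
  · intro h
    have h' : P.DenseBelow (fun q => P.ForcesEl q φ xs ∧ P.ForcesEl q ψ xs) p := by
      intro r hr
      by_contra! hc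
      exact h r hr fun q hq hφ q' hq' hψ => hc q' (hq'.trans hq) (hφ.mono hM hxs hq') hψ
    exact ⟨.of_denseBelow hM hxs hp (h'.imp fun _ _ h => h.1),
      .of_denseBelow hM hxs hp (h'.imp fun _ _ h => h.2)⟩
  · exact fun h q hq hc => hc q (Le.refl hq.1) (h.1.mono hM hxs hq) q (Le.refl hq.1)
      (h.2.mono hM hxs hq)

theorem forcesEl_ex {φ : setLang.BoundedFormula P.Name (n + 1)} {xs : Fin n → M} {p : M} :
    P.ForcesEl p φ.ex xs ↔
      P.DenseBelow (fun q => ∃ x, P.IsName x ∧ P.ForcesEl q φ (Fin.snoc xs x)) p := by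
  change P.ForcesEl p φ.not.all.not xs ↔ _
  rw [forcesEl_not]
  constructor
  · intro h r hr
    by_contra! hc
    exact h r hr fun x hx => forcesEl_not.2 fun q hq => hc q hq x hx
  · intro h q hq hall
    obtain ⟨r, hr, x, hx, h⟩ := h q hq
    exact forcesEl_not.1 (hall x hx) r hr h

/-! ### Standard names and the name of the least ordinal. -/

variable {M : Type u} [setLang.Structure M] {P : ForcingPoset M}

theorem snoc_zero {N : Type u} (xs : Fin 0 → N) (x : N) :
    (Fin.snoc xs x : Fin 1 → N) = fun _ => x := by
  funext i
  obtain rfl : i = Fin.last 0 := Subsingleton.elim (α := Fin 1) _ _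
  exact Fin.snoc_last _ _

/-- `F` is the function of `M` that maps the elements of `T` to their standard names. -/
def IsCheckMap (P : ForcingPoset M) (T F : M) : Prop :=
  (∀ y, y ∈ₘ T → ∃! d, PairMem y d F) ∧
    ∀ y d, y ∈ₘ T → PairMem y d F → ∀ s π, PairMem s π d ↔ s = P.one ∧ ∃ w, w ∈ₘ y ∧ PairMem w π F

theorem IsCheck.exists_isCheckMap (hM : ModelsZF M) {x c : M} (h : P.IsCheck x c) :
    ∃ T F, x ∈ₘ T ∧ IsTrSet T ∧ P.IsCheckMap T F ∧ PairMem x c F := by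
  obtain ⟨T, F, hxT, hT, hF, hrec, hc⟩ := h
  refine ⟨T, F, hxT, hT, ⟨hF, fun y d hy hd s π => ⟨?_, ?_⟩⟩, hc⟩
  · rintro ⟨z, hz, hzd⟩
    obtain ⟨w, e, hw, he, hz'⟩ := (hrec y d hy hd z).1 hzd
    obtain ⟨rfl, rfl⟩ := hz.inj hz'
    exact ⟨rfl, w, hw, he⟩
  · rintro ⟨rfl, w, hw, hπ⟩
    obtain ⟨z, hz⟩ := hM.exists_isPair P.one π
    exact ⟨z, hz, (hrec y d hy hd z).2 ⟨w, π, hw, hπ, hz⟩⟩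

/-- The standard names of the elements of `κ`, given by `F`, are names when that of `κ` is one. -/
theorem IsCheckMap.isName {T F κ k γ c : M} (hF : P.IsCheckMap T F) (hκ : κ ∈ₘ T)
    (hκk : PairMem κ k F) (hk : P.IsName k) (hγ : γ ∈ₘ κ) (hc : PairMem γ c F) : P.IsName c :=
  hk.of_pairMem ((hF.2 κ k hκ hκk P.one c).2 ⟨rfl, γ, hγ, hc⟩)

theorem _root_.ZFForcing.Dfn.forcesEl_const {n : ℕ} (θ : setLang.BoundedFormula P.Name 1)
    {f g : (Fin n → M) → M} (hf : Tm f) (hg : Tm g) :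
    Dfn (fun v => P.ForcesEl (f v) θ (fun _ => g v)) :=
  Dfn.forcesEl θ hf fun _ => hg

/-- `s` forces that no standard name of an element of `γ ∪ {γ}` satisfies `θ`. -/
def Refutes (P : ForcingPoset M) (θ : setLang.BoundedFormula P.Name 1) (F s γ : M) : Prop :=
  ∀ δ d q, (δ ∈ₘ γ ∨ δ = γ) → PairMem δ d F → P.Le q s → ¬ P.ForcesEl q θ (fun _ => d)

theorem _root_.ZFForcing.Dfn.refutes {n : ℕ} (θ : setLang.BoundedFormula P.Name 1) (F : M)
    {f g : (Fin n → M) → M} (hf : Tm f) (hg : Tm g) : Dfn (fun v => P.Refutes θ F (f v) (g v)) := by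
  unfold Refutes
  repeat' with_reducible first
    | exact Pj.id | apply Pj.init | assumption | exact Tm.const _
    | (refine Tm.comp ?_ ?_ <;> [assumption; skip]) | apply Tm.coord
    | apply Dfn.pairMem | apply Dfn.le | apply Dfn.forcesEl_const
    | apply Dfn.mem | apply Dfn.eq | apply Dfn.not | apply Dfn.or | apply Dfn.imp | apply Dfn.all

/-- The name `{(s, γ̌) : γ ∈ κ, s ⊩ ∀ δ ≤ γ̌ ¬ θ(δ)}` of the least ordinal satisfying `θ`. -/
def IsLeastName (P : ForcingPoset M) (θ : setLang.BoundedFormula P.Name 1) (F κ τ : M) : Prop :=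
  ∀ s π, PairMem s π τ ↔
    s ∈ₘ P.carrier ∧ ∃ γ, γ ∈ₘ κ ∧ PairMem γ π F ∧ P.Refutes θ F s γ

theorem exists_isLeastName (hM : ModelsZF M) (θ : setLang.BoundedFormula P.Name 1) {T F κ k : M}
    (hF : P.IsCheckMap T F) (hκ : κ ∈ₘ T) (hκk : PairMem κ k F) (hk : P.IsName k) :
    ∃ τ, P.IsName τ ∧ P.IsLeastName θ F κ τ := by
  -- A closed set of names containing `k` already contains every γ̌ with γ ∈ κ, so it bounds the
  -- second components of τ.
  obtain ⟨N, hkN, hN⟩ := hk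
  obtain ⟨C, hC⟩ := hM.exists_union P.carrier N
  obtain ⟨U, hU⟩ := hM.exists_pairs C
  obtain ⟨τ, hτ⟩ := hM.exists_sep (R := fun z => ∃ s π, IsPair z s π ∧ s ∈ₘ P.carrier ∧
      ∃ γ, γ ∈ₘ κ ∧ PairMem γ π F ∧ P.Refutes θ F s γ) (by
    repeat' with_reducible first
      | exact Pj.id | apply Pj.init | exact Tm.const _ | apply Tm.coord
      | apply Dfn.pairMem | apply Dfn.isPair | apply Dfn.refutes
      | apply Dfn.mem | apply Dfn.and | apply Dfn.ex) U
  have hmem : ∀ {γ π}, γ ∈ₘ κ → PairMem γ π F → π ∈ₘ N := fun hγ hπ =>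
    (hN.of_pairMem hkN ((hF.2 κ k hκ hκk P.one _).2 ⟨rfl, _, hγ, hπ⟩)).2
  obtain ⟨N', hN'⟩ := hM.exists_insert N τ
  refine ⟨τ, ⟨N', (hN' τ).2 (Or.inr rfl), fun y hy z hz => ?_⟩, fun s π => ⟨?_, ?_⟩⟩
  · rcases (hN' y).1 hy with hy | rfl
    · obtain ⟨s, π, hs, hπ, h⟩ := hN y hy z hz
      exact ⟨s, π, hs, (hN' π).2 (Or.inl hπ), h⟩
    · obtain ⟨-, s, π, h, hs, γ, hγ, hπ, -⟩ := (hτ z).1 hz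
      exact ⟨s, π, hs, (hN' π).2 (Or.inl (hmem hγ hπ)), h⟩
  · rintro ⟨z, hz, hzτ⟩
    obtain ⟨-, s', π', hz', h⟩ := (hτ z).1 hzτ
    obtain ⟨rfl, rfl⟩ := hz.inj hz'
    exact h
  · rintro ⟨hs, γ, hγ, hπ, h⟩
    obtain ⟨z, hz⟩ := hM.exists_isPair s π
    exact ⟨z, hz, (hτ z).2 ⟨hU s π z ((hC s).2 (Or.inl hs)) ((hC π).2 (Or.inr (hmem hγ hπ))) hz,
      s, π, hz, hs, γ, hγ, hπ, h⟩⟩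

section LeastName

variable {θ : setLang.BoundedFormula P.Name 1} {T F κ τ : M}

/-- A condition forces `τ` to be `γ̌` if it forces `θ(γ̌)` and `θ(δ̌)` is refuted for all `δ ∈ γ`. -/
theorem IsLeastName.forcesEq (hM : ModelsZF M) (hF : P.IsCheckMap T F) (hκ : IsOrd κ)
    (hκT : ∀ x, x ∈ₘ κ → x ∈ₘ T) (hname : ∀ γ c, γ ∈ₘ κ → PairMem γ c F → P.IsName c)
    (hτ : P.IsLeastName θ F κ τ) (hτn : P.IsName τ) {q γ c : M} (hq : q ∈ₘ P.carrier)
    (hγ : γ ∈ₘ κ) (hc : PairMem γ c F) (hθ : P.ForcesEl q θ (fun _ => c))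
    (hmin : ∀ δ d r, δ ∈ₘ γ → PairMem δ d F → P.Le r q → ¬ P.ForcesEl r θ (fun _ => d)) :
    P.ForcesEq q τ c := by
  refine (forcesEq_iff hM hq hτn (hname γ c hγ hc)).2 ⟨fun s π hs => ?_, fun s π hs => ?_⟩
  · refine .of_forall fun r hr hrs => ?_
    obtain ⟨-, δ, hδ, hπ, href⟩ := (hτ s π).1 hs
    -- Otherwise γ ≤ δ, and the label `s` refutes θ(γ̌), although `r` below `s` forces it.
    have hδγ : δ ∈ₘ γ := by
      by_contra hδγ
      refine href γ c r ?_ hc hrs (hθ.mono hM (fun _ => hname γ c hγ hc) hr)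
      rcases hκ.trichotomy hM hγ hδ with h | h | h
      exacts [Or.inl h, Or.inr h, absurd h hδγ]
    exact ⟨P.one, π, (hF.2 γ c (hκT γ hγ) hc _ _).2 ⟨rfl, δ, hδγ, hπ⟩,
      ⟨hr.1, P.one_mem, P.le_one r hr.1⟩, .refl hM hr.1 (hname δ π hδ hπ)⟩
  · refine .of_forall fun r hr _ => ?_
    obtain ⟨-, δ, hδγ, hπ⟩ := (hF.2 γ c (hκT γ hγ) hc s π).1 hs
    have hδ := hκ.1 γ hγ δ hδγ
    -- The condition `r` can serve as its own label: every ε ≤ δ lies in γ, where `hmin` excludes θ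
    -- below `q`.
    refine ⟨r, π, (hτ r π).2 ⟨hr.1, δ, hδ, hπ, fun ε e r' hε he hr' => ?_⟩, Le.refl hr.1,
      .refl hM hr.1 (hname δ π hδ hπ)⟩
    have hεγ : ε ∈ₘ γ := by
      rcases hε with hε | rfl
      exacts [hκ.2 γ hγ δ hδγ ε hε, hδγ]
    exact hmin ε e r' hεγ he (hr'.trans hr)

theorem IsLeastName.forcesEl (hM : ModelsZF M) (hF : P.IsCheckMap T F) (hκ : IsOrd κ)
    (hκT : ∀ x, x ∈ₘ κ → x ∈ₘ T) (hname : ∀ γ c, γ ∈ₘ κ → PairMem γ c F → P.IsName c)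
    (hτ : P.IsLeastName θ F κ τ) (hτn : P.IsName τ) {p : M} (hp : p ∈ₘ P.carrier)
    (h : P.DenseBelow (fun q => ∃ γ c, γ ∈ₘ κ ∧ PairMem γ c F ∧ P.ForcesEl q θ (fun _ => c)) p) :
    P.ForcesEl p θ (fun _ => τ) := by
  refine .of_denseBelow hM (fun _ => hτn) hp fun r hr => ?_
  obtain ⟨q, hq, γ, c, hγ, hc, hθ⟩ := h r hr
  -- Minimality ranges over all conditions below `r`, not just one `q`, so nothing below the new `q`
  -- forces θ at a smaller ordinal.
  obtain ⟨γ, hγ, ⟨q, c, hq, hc, hθ⟩, hmin⟩ := hM.exists_minimal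
    (R := fun γ => ∃ q c, P.Le q r ∧ PairMem γ c F ∧ P.ForcesEl q θ (fun _ => c)) (by
      repeat' with_reducible first
        | exact Pj.id | apply Pj.init | exact Tm.const _ | apply Tm.coord
        | apply Dfn.pairMem | apply Dfn.le | apply Dfn.forcesEl_const
        | apply Dfn.and | apply Dfn.ex) hγ ⟨q, c, hq, hc, hθ⟩
  have hcn := hname γ c hγ hc
  have heq := hτ.forcesEq hM hF hκ hκT hname hτn hq.1 hγ hc hθ fun δ d r' hδ hd hr' hθ' =>
    hmin δ hδ (hκ.1 γ hγ δ hδ) ⟨r', d, hr'.trans hq, hd, hθ'⟩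
  exact ⟨q, hq, hθ.congr hM (fun _ => hcn) (fun _ => hτn) hq.1
    fun _ => heq.symm hM hq.1 hτn hcn⟩

/-- Members of `τ` are, densely, standard names of ordinals. -/
theorem IsLeastName.denseBelow_of_forcesMem (hτ : P.IsLeastName θ F κ τ) {p x : M}
    (h : P.ForcesMem p x τ) : P.DenseBelow (fun q => ∃ γ c, γ ∈ₘ κ ∧ PairMem γ c F ∧
      P.Refutes θ F q γ ∧ P.ForcesEq q x c) p :=
  DenseBelow.imp h fun q _ ⟨s, c, hs, hqs, hx⟩ => by
    obtain ⟨-, γ, hγ, hc, href⟩ := (hτ s c).1 hs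
    exact ⟨γ, c, hγ, hc, fun δ d r hδ hd hr => href δ d r hδ hd (hr.trans hqs), hx⟩

/-- Members of a standard name are, densely, standard names of elements. -/
theorem IsCheckMap.denseBelow_of_forcesMem (hM : ModelsZF M) (hF : P.IsCheckMap T F)
    {p x y γ c : M} (hγ : γ ∈ₘ T) (hc : PairMem γ c F) (hx : P.IsName x) (hy : P.IsName y)
    (hcn : P.IsName c) (h : P.ForcesMem p y x) (hxc : P.ForcesEq p x c) :
    P.DenseBelow (fun q => ∃ δ d, δ ∈ₘ γ ∧ PairMem δ d F ∧ P.ForcesEq q y d) p := fun r hr => by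
  have h := h.congr hM hy hx hy hcn (.refl hM hr.2.1 hy) hxc
  obtain ⟨q, hq, s, d, hs, -, hyd⟩ := h r hr
  obtain ⟨-, δ, hδ, hd⟩ := (hF.2 γ c hγ hc s d).1 hs
  exact ⟨q, hq, δ, d, hδ, hd, hyd⟩

/-- A condition refuting θ at all ordinals up to γ does so up to each δ ∈ γ, hence is a label of δ̌
in τ. -/
theorem IsLeastName.transitive (hM : ModelsZF M) (hF : P.IsCheckMap T F) (hκ : IsOrd κ)
    (hκT : ∀ x, x ∈ₘ κ → x ∈ₘ T) (hname : ∀ γ c, γ ∈ₘ κ → PairMem γ c F → P.IsName c)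
    (hτ : P.IsLeastName θ F κ τ) (hτn : P.IsName τ) {p x y : M} (hx : P.IsName x)
    (hy : P.IsName y) (hxτ : P.ForcesMem p x τ) (hyx : P.ForcesMem p y x) : P.ForcesMem p y τ := by
  refine DenseBelow.bind fun r hr => ?_
  obtain ⟨q, hq, γ, c, hγ, hc, href, hxc⟩ := hτ.denseBelow_of_forcesMem hxτ r hr
  obtain ⟨q', hq', δ, d, hδ, hd, hyd⟩ := hF.denseBelow_of_forcesMem hM (hκT γ hγ) hc hx hy
    (hname γ c hγ hc) (hyx.mono (hq.trans hr)) hxc q (Le.refl hq.1)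
  have hδκ := hκ.1 γ hγ δ hδ
  have hdn := hname δ d hδκ hd
  refine ⟨q', hq'.trans hq, ForcesMem.congr hM hdn hτn hy hτn (hyd.symm hM hq'.1 hy hdn)
    (.refl hM hq'.1 hτn) (.of_pairMem hM hdn ((hτ q' d).2 ⟨hq'.1, δ, hδκ, hd, ?_⟩) (Le.refl hq'.1))⟩
  intro ε e r' hε he hr'
  refine href ε e r' (Or.inl ?_) he (hr'.trans hq')
  rcases hε with hε | rfl
  exacts [hκ.2 γ hγ δ hδ ε hε, hδ]

/-- Densely, `x`, `y`, `z` are standard names of some γ, δ, ε with ε ∈ δ ∈ γ, and γ is transitive as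
an element of κ. -/
theorem IsLeastName.transitive_of_mem (hM : ModelsZF M) (hF : P.IsCheckMap T F) (hκ : IsOrd κ)
    (hκT : ∀ x, x ∈ₘ κ → x ∈ₘ T) (hname : ∀ γ c, γ ∈ₘ κ → PairMem γ c F → P.IsName c)
    (hτ : P.IsLeastName θ F κ τ) {p x y z : M} (hx : P.IsName x)
    (hy : P.IsName y) (hz : P.IsName z) (hxτ : P.ForcesMem p x τ) (hyx : P.ForcesMem p y x)
    (hzy : P.ForcesMem p z y) : P.ForcesMem p z x := by
  refine DenseBelow.bind fun r hr => ?_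
  obtain ⟨q, hq, γ, c, hγ, hc, -, hxc⟩ := hτ.denseBelow_of_forcesMem hxτ r hr
  have hcn := hname γ c hγ hc
  obtain ⟨q', hq', δ, d, hδ, hd, hyd⟩ := hF.denseBelow_of_forcesMem hM (hκT γ hγ) hc hx hy
    hcn (hyx.mono (hq.trans hr)) hxc q (Le.refl hq.1)
  have hδκ := hκ.1 γ hγ δ hδ
  obtain ⟨q'', hq'', ε, e, hε, he, hze⟩ := hF.denseBelow_of_forcesMem hM (hκT δ hδκ) hd hy hz
    (hname δ d hδκ hd) (hzy.mono (hq'.trans (hq.trans hr))) hyd q' (Le.refl hq'.1)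
  have hen := hname ε e (hκ.1 δ hδκ ε hε) he
  have hqq := hq''.trans hq'
  exact ⟨q'', hqq.trans hq, ForcesMem.congr hM hen hcn hz hx (hze.symm hM hq''.1 hz hen)
    ((hxc.mono hM hx hcn hqq).symm hM hq''.1 hx hcn) (.of_pairMem hM hen
      ((hF.2 γ c (hκT γ hγ) hc P.one e).2 ⟨rfl, ε, hκ.2 γ hγ δ hδ ε hε, he⟩)
      ⟨hq''.1, P.one_mem, P.le_one _ hq''.1⟩)⟩

/-- `Refutes` includes γ itself, so θ(x) would contradict it once `x` is forced to be γ̌. -/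
theorem IsLeastName.not_forcesEl (hM : ModelsZF M)
    (hname : ∀ γ c, γ ∈ₘ κ → PairMem γ c F → P.IsName c) (hτ : P.IsLeastName θ F κ τ) {p x : M}
    (hp : p ∈ₘ P.carrier) (hx : P.IsName x) (hxτ : P.ForcesMem p x τ) :
    ¬ P.ForcesEl p θ (fun _ => x) := by
  intro hθ
  obtain ⟨q, hq, γ, c, hγ, hc, href, hxc⟩ := hτ.denseBelow_of_forcesMem hxτ p (Le.refl hp)
  exact href γ c q (Or.inr rfl) hc (Le.refl hq.1) ((hθ.mono hM (fun _ => hx) hq).congr hM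
    (fun _ => hx) (fun _ => hname γ c hγ hc) hq.1 fun _ => hxc)

end LeastName

/-! ### Unfolding the formulas of the theorem, and its proof. -/

theorem forcesEl_noMemF (hM : ModelsZF M) {θ : setLang.BoundedFormula P.Name 1} {τ : P.Name}
    {p : M} {xs : Fin 0 → M} :
    P.ForcesEl p (noMemF τ θ) xs ↔ ∀ x, P.IsName x → ∀ q, P.Le q p → P.ForcesMem q x τ.1 →
      ¬ P.ForcesEl q θ (fun _ => x) := by
  refine forall₂_congr fun x hx => ?_
  rw [snoc_zero, forcesEl_imp hM fun _ => hx]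
  simp only [forcesEl_not]
  exact ⟨fun h q hq hm => h q hq hm q (Le.refl hq.1),
    fun h q hq hm r hr => h r (hr.trans hq) (ForcesMem.mono hm hr)⟩

theorem forcesEl_ordF (hM : ModelsZF M) {τ : P.Name} {p : M} (hp : p ∈ₘ P.carrier)
    {xs : Fin 0 → M} (h₁ : ∀ x y q, P.IsName x → P.IsName y → P.Le q p → P.ForcesMem q x τ.1 →
      P.ForcesMem q y x → P.ForcesMem q y τ.1)
    (h₂ : ∀ x y z q, P.IsName x → P.IsName y → P.IsName z → P.Le q p → P.ForcesMem q x τ.1 →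
      P.ForcesMem q y x → P.ForcesMem q z y → P.ForcesMem q z x) :
    P.ForcesEl p (ordF τ) xs := by
  have hxs : ∀ i, P.IsName (xs i) := fun i => i.elim0
  refine (forcesEl_inf hM hxs hp).2 ⟨fun x hx => ?_, fun x hx => ?_⟩
  · refine (forcesEl_imp hM (isName_snoc hxs hx)).2 fun q hq hxτ y hy => ?_
    refine (forcesEl_imp hM (isName_snoc (isName_snoc hxs hx) hy)).2 fun r hr hyx => ?_
    exact h₁ x y r hx hy (hr.trans hq) (ForcesMem.mono hxτ hr) hyx
  · refine (forcesEl_imp hM (isName_snoc hxs hx)).2 fun q hq hxτ y hy => ?_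
    refine (forcesEl_imp hM (isName_snoc (isName_snoc hxs hx) hy)).2 fun r hr hyx z hz => ?_
    refine (forcesEl_imp hM (isName_snoc (isName_snoc (isName_snoc hxs hx) hy) hz)).2
      fun r' hr' hzy => ?_
    exact h₂ x y z r' hx hy hz (hr'.trans (hr.trans hq)) (ForcesMem.mono hxτ (hr'.trans hr))
      (ForcesMem.mono hyx hr') hzy

theorem forcesEl_exMemF (hM : ModelsZF M) {θ : setLang.BoundedFormula P.Name 1} {k : P.Name}
    {p : M} {xs : Fin 0 → M} : P.ForcesEl p (exMemF k θ) xs ↔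
      P.DenseBelow (fun q => ∃ x, P.IsName x ∧ P.ForcesMem q x k.1 ∧
        P.ForcesEl q θ (fun _ => x)) p := by
  refine forcesEl_ex.trans (forall₂_congr fun r _ => exists_congr fun q =>
    and_congr_right fun hq => exists_congr fun x => and_congr_right fun hx => ?_)
  rw [snoc_zero, forcesEl_inf hM (fun _ => hx) hq.1]
  rfl

end ForcingPoset
end ZFForcing

open ZFForcing
/-- A theorem of ZF, i.e. true in every model `M` of ZF. -/
theorem proposition3 {M : Type u} [setLang.Structure M] (hM : ModelsZF M)
    (P : ForcingPoset M) (p : M) (hp : p ∈ₘ P.carrier)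
    (κ : M) (hκ : IsOrd κ) (k : P.Name) (hk : P.IsCheck κ k.1)
    (θ : setLang.BoundedFormula P.Name 1)
    (h : P.Forces p (exMemF k θ) ![]) :
    ∃ τ : P.Name, P.Forces p θ ![τ] ∧
      P.Forces p (ordF τ) ![] ∧ P.Forces p (noMemF τ θ) ![] := by
  obtain ⟨T, F, hκT, hT, hF, hκk⟩ := ForcingPoset.IsCheck.exists_isCheckMap hM hk
  have hname := fun γ c => hF.isName (γ := γ) (c := c) hκT hκk k.2
  have hsub := hT κ hκT
  obtain ⟨τ, hτn, hτ⟩ := ForcingPoset.exists_isLeastName hM θ hF hκT hκk k.2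
  rw [ForcingPoset.forces_iff_forcesEl, ForcingPoset.forcesEl_exMemF hM] at h
  refine ⟨⟨τ, hτn⟩, ?_, ?_, ?_⟩
  · rw [ForcingPoset.forces_iff_forcesEl]
    have hv : (fun i => ((![⟨τ, hτn⟩] : Fin 1 → P.Name) i).1) = fun _ => τ := by
      funext i
      obtain rfl : i = 0 := Subsingleton.elim _ _
      rfl
    rw [hv]
    -- Two density steps: first some name `x` is forced into `k` and to satisfy θ, then `x` is
    -- forced to equal some γ̌ with γ ∈ κ.
    refine hτ.forcesEl hM hF hκ hsub hname hτn hp (ForcingPoset.DenseBelow.bind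
      (h.imp fun q hq ⟨x, hx, hxk, hθ⟩ => ForcingPoset.DenseBelow.imp
        (hF.denseBelow_of_forcesMem hM hκT hκk k.2 hx k.2 hxk (.refl hM hq.1 k.2)) ?_))
    rintro r hr ⟨γ, c, hγ, hc, hxc⟩
    exact ⟨γ, c, hγ, hc, (hθ.mono hM (fun _ => hx) hr).congr hM (fun _ => hx)
      (fun _ => hname γ c hγ hc) hr.1 fun _ => hxc⟩
  · rw [ForcingPoset.forces_iff_forcesEl]
    exact ForcingPoset.forcesEl_ordF hM hp
      (fun x y q hx hy _ => hτ.transitive hM hF hκ hsub hname hτn hx hy)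
      (fun x y z q hx hy hz _ => hτ.transitive_of_mem hM hF hκ hsub hname hx hy hz)
  · rw [ForcingPoset.forces_iff_forcesEl]
    exact (ForcingPoset.forcesEl_noMemF hM).2 fun x hx q hq => hτ.not_forcesEl hM hname hq.1 hx
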